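/- Let $G=(V,E)$ be a finite graph. The edge-model joining process on $G$ is the following. Initially every vertex is active. As long as some edge of $G$ joins two active vertices, choose a directed edge $(v,u)$ between active vertices of $G$ uniformly at random (each edge of $G$ giving two directed edges); then $v$ becomes passive and directs an edge to $u$. The process ends when no edge of $G$ joins two active vertices. At the end, the vertices are partitioned into fragments, each being a directed tree rooted at exactly one active vertex. For $n\ge 1$, $N=\binom n2$ and $0\le m\le N$, let $G(n,m)$ be a uniformly random graph on $n$ labelled vertices with exactly $m$ edges, and let $a(m)$ be the number of active vertices (equivalently, of fragments) at the end of the edge-model joining process run on $G(n,m)$. (i) Let $\omega=\omega(n)\to\infty$ as $n\to\infty$, and let $m=m(n)$ be integers with $0\le m\le N$ and $m\le N/\omega$ for all large $n$. Then, as $n\to\infty$, $a(m)$ is concentrated: for every $\varepsilon>0$, $$\mathbb P\bigl(|a(m)-\mathbb E\,a(m)|\ge \varepsilon\,\mathbb E\,a(m)\bigr)\to 0,$$ and $$\mathbb E\,a(m)\sim \frac{1}{1-(1-1/n)\sqrt{1-m/N}},\qquad \mathbb E\,a(m)\sim\frac{n^2}{n+m}.$$ (ii) For every $n\ge 2$ and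 every $0\le m\le N$ (in particular for every $m\le N(1-o(1))$), $$\mathbb E\,a(m)\le \frac{1}{1-(1-1/n)\sqrt{1-m/N}}.$$ -/

import Mathlib

open Filter Asymptotics
open scoped Topology

noncomputable section

namespace Joining

/-- A state of the joining protocol on the vertex set `V`. The value `σ v = none` means that `v` is
active; `σ v = some u` means that `v` is passive and directs an edge to `u` in the fragment graph.
The fragments are the resulting directed trees, each rooted at its unique active vertex. -/
abbrev State (V : Type*) := V → Option V

/-- Initially all vertices are active. -/
def initial (V : Type*) : State V := fun _ => none

section Protocol

open scoped Classical

variable {V : Type*} [Fintype V]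

/-- The set of active vertices; it has one element for each fragment. -/
def active (σ : State V) : Finset V := Finset.univ.filter fun v => σ v = none

/-- The directed edges `(v, u)` of `G` between active vertices. -/
def activeEdges (G : SimpleGraph V) (σ : State V) : Finset (V × V) :=
  Finset.univ.filter fun e => G.Adj e.1 e.2 ∧ e.1 ∈ active σ ∧ e.2 ∈ active σ

/-- One step of the edge model: a directed edge `(v, u)` between active vertices is chosen
uniformly at random, `v` becomes passive and directs an edge to `u`. If all active vertices are
isolated, the process has ended and the state no longer changes. -/
def step (G : SimpleGraph V) (σ : State V) : PMF (State V) :=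
  if h : (activeEdges G σ).Nonempty then
    (PMF.uniformOfFinset (activeEdges G σ) h).map fun e => Function.update σ e.1 (some e.2)
  else PMF.pure σ

/-- The law of the state after `k` steps of the edge model on `G`. -/
def run (G : SimpleGraph V) : ℕ → PMF (State V)
  | 0 => PMF.pure (initial V)
  | k + 1 => (run G k).bind (step G)

/-- The law of the state at the end of the process. Every step before the end makes one vertex
passive, so the process has ended after at most `|V|` steps (see `activeEdges_of_mem_final`). -/
def final (G : SimpleGraph V) : PMF (State V) := run G (Fintype.card V)

theorem run_support (G : SimpleGraph V) (k : ℕ) (σ : State V) (hσ : σ ∈ (run G k).support) :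
    activeEdges G σ = ∅ ∨ (active σ).card + k = Fintype.card V := by
  induction k generalizing σ with
  | zero =>
    right
    simp only [run, PMF.support_pure, Set.mem_singleton_iff] at hσ
    subst hσ
    simp [active, initial]
  | succ k ih =>
    simp only [run, PMF.mem_support_bind_iff] at hσ
    obtain ⟨τ, hτ, hs⟩ := hσ
    unfold step at hs
    split_ifs at hs with h
    · right
      rw [PMF.mem_support_map_iff] at hs
      obtain ⟨e, he, rfl⟩ := hs
      rw [PMF.mem_support_uniformOfFinset_iff] at he
      rcases ih τ hτ with h0 | h1
      · simp [h0] at h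
      · have hmem : e.1 ∈ active τ := by
          simp only [activeEdges, Finset.mem_filter] at he
          exact he.2.2.1
        have : active (Function.update τ e.1 (some e.2)) = (active τ).erase e.1 := by
          ext w
          by_cases hw : w = e.1
          · subst hw; simp [active]
          · simp [active, hw]
        rw [this]
        have := Finset.card_erase_add_one hmem
        omega
    · left
      simp only [PMF.support_pure, Set.mem_singleton_iff] at hs
      subst hs
      exact Finset.not_nonempty_iff_eq_empty.mp h

/-- In the final state all active vertices are isolated. -/
theorem activeEdges_of_mem_final (G : SimpleGraph V) (σ : State V)
    (hσ : σ ∈ (final G).support) : activeEdges G σ = ∅ := by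
  rcases run_support G _ σ hσ with h | h
  · exact h
  · have h0 : active σ = ∅ := by
      rw [← Finset.card_eq_zero]
      omega
    simp [activeEdges, h0]

/-- The graphs on `V` with exactly `m` edges. -/
def graphsWith (V : Type*) [Fintype V] (m : ℕ) : Finset (SimpleGraph V) :=
  Finset.univ.filter fun G => G.edgeFinset.card = m

theorem graphsWith_nonempty {n m : ℕ} (hm : m ≤ n.choose 2) :
    (graphsWith (Fin n) m).Nonempty := by
  have hc : m ≤ ((⊤ : SimpleGraph (Fin n)).edgeFinset).card := by
    rw [SimpleGraph.card_edgeFinset_top_eq_card_choose_two, Fintype.card_fin]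
    exact hm
  obtain ⟨s, hs, hcard⟩ := Finset.exists_subset_card_eq hc
  refine ⟨SimpleGraph.fromEdgeSet (s : Set (Sym2 (Fin n))), ?_⟩
  simp only [graphsWith, Finset.mem_filter, Finset.mem_univ, true_and]
  rw [← hcard]
  congr 1
  ext e
  have := fun h : e ∈ s => hs h
  simp only [SimpleGraph.mem_edgeFinset, SimpleGraph.edgeSet_fromEdgeSet, Set.mem_sdiff,
    SimpleGraph.edgeSet_top] at this ⊢
  constructor
  · exact fun h => h.1
  · exact fun h => ⟨h, this h⟩

/-- The random graph `G(n, m)`: uniform over all graphs on `n` labelled vertices with `m` edges. -/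
def gnm (n m : ℕ) (hm : m ≤ n.choose 2) : PMF (SimpleGraph (Fin n)) :=
  PMF.uniformOfFinset (graphsWith (Fin n) m) (graphsWith_nonempty hm)

end Protocol

/-- The law of `a(m)`, the number of active vertices (that is, of fragments) at the end of the
edge-model joining process run on the random graph `G(n, m)`. -/
def activeLaw (n m : ℕ) (hm : m ≤ n.choose 2) : PMF ℕ :=
  (gnm n m hm).bind fun G => (final G).map fun σ => (active σ).card

/-- The expectation `E a(m)`. -/
def expectedActive (n m : ℕ) (hm : m ≤ n.choose 2) : ℝ :=
  ∫ k : ℕ, (k : ℝ) ∂(activeLaw n m hm).toMeasure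

/-- The function `1 / (1 - (1 - 1/n) √(1 - m/N))` with `N = n.choose 2`. -/
def meanField (n m : ℕ) : ℝ :=
  1 / (1 - (1 - 1 / (n : ℝ)) * Real.sqrt (1 - (m : ℝ) / (n.choose 2 : ℝ)))

end Joining

end

/-! The edge model amounts to processing the edges in uniformly random order, where an edge with two
active ends deactivates one of them. So the edge processed last may be taken uniform and independent
of the run on the rest (`sum_endValue_deleteEdges`). Removing a uniform edge from `G(n, m+1)` leaves
`G(n, m)` together with a uniform non-edge (`sum_graphsWith_succ`). At the end of the run on `G(n,
m)` the active set is independent, so all `a(a-1)/2` of its pairs are non-edges. Hence the law of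
`a` evolves in `m` as a pure death chain with death probability `a(a-1) / (2(N-m))`, which is
`integral_activeLaw_succ`.

The chain is solvable on one test function: for `φ k = 1/(k+1)` the recursion closes up, and `E
1/(a+1) = 1/B` with `B = n(n+1)/(n+m)` (`integral_inv_activeLaw`). Jensen gives `E a ≥ B - 1`. From
above, convexity of `k(k-1)/2` compares `E a` step by step with the mean field, which is at most
`n²/(n+m)` because `√(1-x) ≤ 1 - x/2`. These bounds pinch when `m = o(n²)`, giving both asymptotics.
They also make `E (a+1) · E 1/(a+1) - 1` at most `1/B`; this is the mean of a squared relative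
deviation, so Markov's inequality yields concentration. -/

namespace Joining

/-! ### The process on a fixed graph, and exchanging the order of its edges. -/

section EndValue

open scoped Classical

variable {V : Type*} [Fintype V]

/-- The directed edges of `G` inside `S`. -/
noncomputable def arcs (G : SimpleGraph V) (S : Finset V) : Finset (V × V) :=
  Finset.univ.filter fun e => G.Adj e.1 e.2 ∧ e.1 ∈ S ∧ e.2 ∈ S

theorem mem_arcs {G : SimpleGraph V} {S : Finset V} {e : V × V} :
    e ∈ arcs G S ↔ G.Adj e.1 e.2 ∧ e.1 ∈ S ∧ e.2 ∈ S := by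
  simp [arcs]

/-- The expectation of `ψ T`, where `T` is the set of active vertices reached after at most `k`
steps of the edge model on `G` started with the set `S` of active vertices. -/
noncomputable def endValue (G : SimpleGraph V) (ψ : Finset V → ℝ) : ℕ → Finset V → ℝ
  | 0, S => ψ S
  | k + 1, S => if (arcs G S).Nonempty then
      (∑ e ∈ arcs G S, endValue G ψ k (S.erase e.1)) / (arcs G S).card else ψ S

theorem endValue_of_arcs_eq_empty {G : SimpleGraph V} (ψ : Finset V → ℝ) (k : ℕ) {S : Finset V}
    (h : arcs G S = ∅) : endValue G ψ k S = ψ S := by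
  cases k <;> simp [endValue, h]

theorem card_mul_endValue_succ (G : SimpleGraph V) (ψ : Finset V → ℝ) (k : ℕ) (S : Finset V) :
    ((arcs G S).card : ℝ) * endValue G ψ (k + 1) S =
      ∑ e ∈ arcs G S, endValue G ψ k (S.erase e.1) := by
  by_cases h : (arcs G S).Nonempty
  · have : ((arcs G S).card : ℝ) ≠ 0 := by
      exact_mod_cast h.card_ne_zero
    simp only [endValue, h, if_true]
    field_simp
  · simp [Finset.not_nonempty_iff_eq_empty.mp h]

/-- The expected final value depends only on the edges and on the values of `ψ` inside `S`. -/
theorem endValue_congr {G H : SimpleGraph V} {ψ χ : Finset V → ℝ} (k : ℕ) {S : Finset V}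
    (hGH : ∀ v ∈ S, ∀ u ∈ S, G.Adj v u ↔ H.Adj v u) (hψ : ∀ T ⊆ S, ψ T = χ T) :
    endValue G ψ k S = endValue H χ k S := by
  induction k generalizing S with
  | zero => exact hψ S subset_rfl
  | succ k ih =>
    have harcs : arcs G S = arcs H S := by
      ext e
      simp only [mem_arcs]
      constructor
      · exact fun h => ⟨(hGH _ h.2.1 _ h.2.2).1 h.1, h.2⟩
      · exact fun h => ⟨(hGH _ h.2.1 _ h.2.2).2 h.1, h.2⟩
    simp only [endValue, harcs, hψ S subset_rfl]
    congr 2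
    refine Finset.sum_congr rfl fun e _ => ih ?_ ?_
    · exact fun v hv u hu => hGH v (Finset.mem_of_mem_erase hv) u (Finset.mem_of_mem_erase hu)
    · exact fun T hT => hψ T (hT.trans (Finset.erase_subset _ _))

/-- Only the values of `ψ` on independent sets matter if there are enough steps. -/
theorem endValue_congr_of_card_le {G : SimpleGraph V} {ψ χ : Finset V → ℝ}
    (hψ : ∀ T, arcs G T = ∅ → ψ T = χ T) (k : ℕ) {S : Finset V} (hS : S.card ≤ k) :
    endValue G ψ k S = endValue G χ k S := by
  induction k generalizing S with
  | zero =>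
    have : S = ∅ := Finset.card_eq_zero.mp (by omega)
    subst this
    exact hψ ∅ (by ext; simp [mem_arcs])
  | succ k ih =>
    by_cases h : (arcs G S).Nonempty
    · simp only [endValue, h, if_true]
      congr 1
      refine Finset.sum_congr rfl fun e he => ih ?_
      have := Finset.card_erase_add_one (mem_arcs.mp he).2.1
      omega
    · have h0 := Finset.not_nonempty_iff_eq_empty.mp h
      rw [endValue_of_arcs_eq_empty _ _ h0, endValue_of_arcs_eq_empty _ _ h0, hψ S h0]

theorem endValue_sum {ι : Type*} (G : SimpleGraph V) (s : Finset ι) (ψ : ι → Finset V → ℝ)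
    (k : ℕ) (S : Finset V) :
    endValue G (fun T => ∑ i ∈ s, ψ i T) k S = ∑ i ∈ s, endValue G (ψ i) k S := by
  induction k generalizing S with
  | zero => rfl
  | succ k ih =>
    simp only [endValue]
    split_ifs
    · rw [← Finset.sum_div, Finset.sum_comm]
      simp only [ih]
    · rfl

theorem endValue_const (G : SimpleGraph V) (c : ℝ) (k : ℕ) (S : Finset V) :
    endValue G (fun _ => c) k S = c := by
  induction k generalizing S with
  | zero => rfl
  | succ k ih =>
    simp only [endValue, ih]
    split_ifs with h
    · have : ((arcs G S).card : ℝ) ≠ 0 := by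
        exact_mod_cast h.card_ne_zero
      simp [this]
    · rfl

/-- The value `φ` of the number of active vertices after the pair `e` has been processed, if `T` is
the set of active vertices before. -/
noncomputable def afterPair (φ : ℕ → ℝ) (e : V × V) (T : Finset V) : ℝ :=
  if e.1 ∈ T ∧ e.2 ∈ T then φ (T.card - 1) else φ T.card

/-- A pair with an inactive end is never chosen, and it remains without effect when processed last,
since active sets only shrink. -/
theorem endValue_deleteEdges_of_not_subset (G : SimpleGraph V) (φ : ℕ → ℝ) (k : ℕ) {S : Finset V}
    {e : V × V} (he : ¬(e.1 ∈ S ∧ e.2 ∈ S)) :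
    endValue (G.deleteEdges {s(e.1, e.2)}) (afterPair φ e) k S =
      endValue G (fun T => φ T.card) k S := by
  refine endValue_congr k ?_ ?_
  · intro v hv u hu
    simp only [SimpleGraph.deleteEdges_adj, Set.mem_singleton_iff, Sym2.eq_iff]
    constructor
    · exact fun h => h.1
    · refine fun h => ⟨h, ?_⟩
      rintro (⟨rfl, rfl⟩ | ⟨rfl, rfl⟩)
      · exact he ⟨hv, hu⟩
      · exact he ⟨hu, hv⟩
  · intro T hT
    have : ¬(e.1 ∈ T ∧ e.2 ∈ T) := fun h => he ⟨hT h.1, hT h.2⟩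
    simp [afterPair, this]

theorem arcs_deleteEdges (G : SimpleGraph V) (S : Finset V) (e : V × V) :
    arcs (G.deleteEdges {s(e.1, e.2)}) S = arcs G S \ {e, e.swap} := by
  ext f
  obtain ⟨a, b⟩ := e
  obtain ⟨c, d⟩ := f
  simp only [mem_arcs, SimpleGraph.deleteEdges_adj, Set.mem_singleton_iff, Sym2.eq_iff,
    Finset.mem_sdiff, Finset.mem_insert, Finset.mem_singleton, Prod.swap_prod_mk, Prod.mk.injEq]
  tauto

theorem swap_mem_arcs {G : SimpleGraph V} {S : Finset V} {e : V × V} (he : e ∈ arcs G S) :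
    e.swap ∈ arcs G S := by
  rw [mem_arcs] at he ⊢
  exact ⟨he.1.symm, he.2.2, he.2.1⟩

theorem card_arcs_sdiff {G : SimpleGraph V} {S : Finset V} {e : V × V} (he : e ∈ arcs G S) :
    (arcs G S \ {e, e.swap}).card + 2 = (arcs G S).card := by
  have hne : e ≠ e.swap := by
    intro h
    have h1 := (mem_arcs.mp he).1.ne
    exact h1 (congrArg Prod.fst h)
  rw [← Finset.card_pair hne]
  refine Finset.card_sdiff_add_card_eq_card ?_
  intro f hf
  rcases Finset.mem_insert.mp hf with rfl | hf
  · exact he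
  · rw [Finset.mem_singleton.mp hf]
    exact swap_mem_arcs he

/-- Processing a uniformly random edge last does not change the law of the number of active
vertices at the end. -/
theorem sum_endValue_deleteEdges (G : SimpleGraph V) (φ : ℕ → ℝ) (k : ℕ) {S : Finset V}
    (hS : S.card ≤ k) {Q : Finset (V × V)} (hQ : arcs G S ⊆ Q) (hQG : ∀ e ∈ Q, G.Adj e.1 e.2) :
    ∑ e ∈ Q, endValue (G.deleteEdges {s(e.1, e.2)}) (afterPair φ e) k S =
      Q.card * endValue G (fun T => φ T.card) k S := by
  suffices h : ∑ e ∈ arcs G S, endValue (G.deleteEdges {s(e.1, e.2)}) (afterPair φ e) k S =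
      (arcs G S).card * endValue G (fun T => φ T.card) k S by
    rw [← Finset.sum_sdiff hQ, h, ← Finset.card_sdiff_add_card_eq_card hQ, Nat.cast_add, add_mul]
    congr 1
    rw [← nsmul_eq_mul, ← Finset.sum_const]
    refine Finset.sum_congr rfl fun e he => endValue_deleteEdges_of_not_subset G φ k ?_
    rw [Finset.mem_sdiff, mem_arcs] at he
    exact fun h => he.2 ⟨hQG e he.1, h⟩
  induction k generalizing S Q with
  | zero =>
    have : S = ∅ := Finset.card_eq_zero.mp (by omega)
    subst this
    have : arcs G ∅ = ∅ := by ext; simp [mem_arcs]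
    simp [this]
  | succ k ih =>
    -- Induction after a first step `f`: arcs that lost an end through `f` contribute the unchanged
    -- value, the others are covered by `ih`.
    have inner : ∀ f ∈ arcs G S,
        ∑ e ∈ arcs G S \ {f, f.swap},
          endValue (G.deleteEdges {s(e.1, e.2)}) (afterPair φ e) k (S.erase f.1) =
        ((arcs G S \ {f, f.swap}).card : ℝ) *
          endValue G (fun T => φ T.card) k (S.erase f.1) := by
      intro f hf
      have hcard := Finset.card_erase_add_one (mem_arcs.mp hf).2.1
      have hsub : arcs G (S.erase f.1) ⊆ arcs G S \ {f, f.swap} := by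
        intro e he
        simp only [mem_arcs, Finset.mem_sdiff, Finset.mem_insert, Finset.mem_singleton,
          Finset.mem_erase] at he ⊢
        refine ⟨⟨he.1, he.2.1.2, he.2.2.2⟩, ?_⟩
        rintro (rfl | rfl)
        · exact he.2.1.1 rfl
        · exact he.2.2.1 rfl
      have h := ih (S := S.erase f.1) (by omega) subset_rfl (fun e he => (mem_arcs.mp he).1)
      rw [← Finset.sum_sdiff hsub, h, ← Finset.card_sdiff_add_card_eq_card hsub, Nat.cast_add,
        add_mul]
      congr 1
      rw [← nsmul_eq_mul, ← Finset.sum_const]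
      refine Finset.sum_congr rfl fun e he => endValue_deleteEdges_of_not_subset G φ k ?_
      rw [Finset.mem_sdiff, Finset.mem_sdiff] at he
      exact fun h => he.2 (mem_arcs.mpr ⟨(mem_arcs.mp he.1.1).1, h⟩)
    rw [card_mul_endValue_succ]
    rcases (arcs G S).eq_empty_or_nonempty with h0 | ⟨e₀, he₀⟩
    · simp [h0]
    have hM := card_arcs_sdiff he₀
    -- Deleting an edge removes two arcs, so the first step on the smaller graph averages over `card
    -- - 2` arcs. A single remaining edge must be treated apart: it is both first and last.
    rcases Nat.eq_or_lt_of_le (show 2 ≤ (arcs G S).card by omega) with h2 | h2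
    · refine Finset.sum_congr rfl fun e he => ?_
      have h3 := card_arcs_sdiff he
      have hempty : arcs G S \ {e, e.swap} = ∅ := Finset.card_eq_zero.mp (by omega)
      have hempty' : arcs G (S.erase e.1) = ∅ := by
        rw [← Finset.subset_empty, ← hempty]
        intro f hf
        simp only [mem_arcs, Finset.mem_sdiff, Finset.mem_insert, Finset.mem_singleton,
          Finset.mem_erase] at hf ⊢
        refine ⟨⟨hf.1, hf.2.1.2, hf.2.2.2⟩, ?_⟩
        rintro (rfl | rfl)
        · exact hf.2.1.1 rfl
        · exact hf.2.2.1 rfl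
      rw [endValue_of_arcs_eq_empty _ _ (by rw [arcs_deleteEdges, hempty]),
        endValue_of_arcs_eq_empty _ _ hempty', afterPair, if_pos (mem_arcs.mp he).2,
        Finset.card_erase_of_mem (mem_arcs.mp he).2.1]
    · have hM2 : ((arcs G S).card : ℝ) - 2 ≠ 0 := by
        have : (2 : ℝ) < (arcs G S).card := by exact_mod_cast h2
        linarith
      have hcast : ∀ e ∈ arcs G S,
          ((arcs G S \ {e, e.swap}).card : ℝ) = (arcs G S).card - 2 := by
        intro e he
        rw [← card_arcs_sdiff he]
        push_cast
        ring
      have expand : ∀ e ∈ arcs G S,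
          ((arcs G S).card - 2 : ℝ) *
            endValue (G.deleteEdges {s(e.1, e.2)}) (afterPair φ e) (k + 1) S =
          ∑ f ∈ arcs G S \ {e, e.swap},
            endValue (G.deleteEdges {s(e.1, e.2)}) (afterPair φ e) k (S.erase f.1) := by
        intro e he
        rw [← hcast e he, ← arcs_deleteEdges, card_mul_endValue_succ]
      apply mul_left_cancel₀ hM2
      rw [Finset.mul_sum, Finset.sum_congr rfl expand, Finset.mul_sum]
      -- Being arcs of distinct edges is a symmetric relation, so "last `e`, then first `f`" may be
      -- summed in the other order.
      rw [Finset.sum_comm' (t' := arcs G S) (s' := fun f => arcs G S \ {f, f.swap})]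
      · refine Finset.sum_congr rfl fun f hf => ?_
        rw [inner f hf, hcast f hf]
      · rintro ⟨a, b⟩ ⟨c, d⟩
        simp only [Finset.mem_sdiff, Finset.mem_insert, Finset.mem_singleton, Prod.swap_prod_mk,
          Prod.mk.injEq]
        tauto

end EndValue

theorem deleteEdges_sup_edge {V : Type*} {G : SimpleGraph V} {a b : V} (h : G.Adj a b) :
    G.deleteEdges {s(a, b)} ⊔ SimpleGraph.edge a b = G := by
  ext v u
  simp only [SimpleGraph.sup_adj, SimpleGraph.deleteEdges_adj, Set.mem_singleton_iff, Sym2.eq_iff,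
    SimpleGraph.edge_adj]
  constructor
  · rintro (h' | ⟨⟨rfl, rfl⟩ | ⟨rfl, rfl⟩, -⟩)
    exacts [h'.1, h, h.symm]
  · intro h'
    have := h'.ne
    tauto

theorem sup_edge_deleteEdges {V : Type*} {G : SimpleGraph V} {a b : V} (h : ¬G.Adj a b) :
    (G ⊔ SimpleGraph.edge a b).deleteEdges {s(a, b)} = G := by
  ext v u
  simp only [SimpleGraph.sup_adj, SimpleGraph.deleteEdges_adj, Set.mem_singleton_iff, Sym2.eq_iff,
    SimpleGraph.edge_adj]
  constructor
  · tauto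
  · refine fun h' => ⟨Or.inl h', ?_⟩
    rintro (⟨rfl, rfl⟩ | ⟨rfl, rfl⟩)
    exacts [h h', h h'.symm]

/-! ### Passing from `m` to `m + 1` edges by double counting. -/

section DoubleCounting

open scoped Classical

variable {V : Type*} [Fintype V]

theorem card_arcs_univ (G : SimpleGraph V) :
    (arcs G Finset.univ).card = 2 * G.edgeFinset.card := by
  rw [← SimpleGraph.sum_degrees_eq_twice_card_edges, arcs, Finset.card_filter,
    ← Finset.univ_product_univ, Finset.sum_product]
  refine Finset.sum_congr rfl fun v _ => ?_
  rw [← Finset.card_filter, ← SimpleGraph.card_neighborFinset_eq_degree]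
  congr 1
  ext u
  simp

theorem mem_graphsWith {G : SimpleGraph V} {m : ℕ} :
    G ∈ graphsWith V m ↔ (arcs G Finset.univ).card = 2 * m := by
  rw [card_arcs_univ]
  simp only [graphsWith, Finset.mem_filter, Finset.mem_univ, true_and]
  omega

theorem card_arcs_compl (G : SimpleGraph V) :
    (arcs Gᶜ Finset.univ).card + (arcs G Finset.univ).card =
      Fintype.card V * Fintype.card V - Fintype.card V := by
  have h : (Finset.univ : Finset V).offDiag = arcs Gᶜ Finset.univ ∪ arcs G Finset.univ := by
    ext e
    simp only [Finset.mem_offDiag, Finset.mem_univ, true_and, Finset.mem_union, mem_arcs, and_true,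
      SimpleGraph.compl_adj]
    have : G.Adj e.1 e.2 → e.1 ≠ e.2 := fun h => h.ne
    tauto
  rw [← Finset.card_univ, ← Finset.offDiag_card, h, Finset.card_union_of_disjoint]
  rw [Finset.disjoint_left]
  intro e he hadj
  exact ((SimpleGraph.compl_adj _ _ _).mp (mem_arcs.mp he).1).2 (mem_arcs.mp hadj).1

/-- A graph with `m + 1` edges and one of its edges correspond to a graph with `m` edges and one of
its non-edges. -/
theorem sum_graphsWith_succ (m : ℕ) (F : SimpleGraph V → V × V → ℝ) :
    ∑ H ∈ graphsWith V (m + 1), ∑ e ∈ arcs H Finset.univ, F (H.deleteEdges {s(e.1, e.2)}) e =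
      ∑ G ∈ graphsWith V m, ∑ e ∈ arcs Gᶜ Finset.univ, F G e := by
  rw [Finset.sum_sigma', Finset.sum_sigma']
  refine Finset.sum_bij' (fun x _ => ⟨x.1.deleteEdges {s(x.2.1, x.2.2)}, x.2⟩)
    (fun x _ => ⟨x.1 ⊔ SimpleGraph.edge x.2.1 x.2.2, x.2⟩) ?_ ?_ ?_ ?_ ?_
  · rintro ⟨H, e⟩ hx
    rw [Finset.mem_sigma, mem_graphsWith] at hx
    have hc := card_arcs_sdiff hx.2
    rw [← arcs_deleteEdges] at hc
    have hadj := (mem_arcs.mp hx.2).1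
    rw [Finset.mem_sigma, mem_graphsWith, mem_arcs]
    refine ⟨by simp only at hx hc ⊢; omega, ?_⟩
    simp [SimpleGraph.compl_adj, hadj.ne]
  · rintro ⟨G, e⟩ hx
    simp only [Finset.mem_sigma, mem_graphsWith, mem_arcs, SimpleGraph.compl_adj, Finset.mem_univ,
      and_true] at hx
    have he : e ∈ arcs (G ⊔ SimpleGraph.edge e.1 e.2) Finset.univ := by
      simp [mem_arcs, SimpleGraph.edge_adj, hx.2.1]
    have hc := card_arcs_sdiff he
    rw [← arcs_deleteEdges, sup_edge_deleteEdges hx.2.2] at hc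
    rw [Finset.mem_sigma, mem_graphsWith]
    exact ⟨by simp only at hc ⊢; omega, he⟩
  · rintro ⟨H, e⟩ hx
    rw [Finset.mem_sigma] at hx
    simp only [deleteEdges_sup_edge (mem_arcs.mp hx.2).1]
  · rintro ⟨G, e⟩ hx
    simp only [Finset.mem_sigma, mem_arcs, SimpleGraph.compl_adj] at hx
    simp only [sup_edge_deleteEdges hx.2.1.2]
  · rintro ⟨H, e⟩ _
    rfl

/-- Independence of `T` makes every ordered pair of distinct vertices of `T` an arc of the
complement; exactly these arcs lower the count. -/
theorem sum_afterPair {G : SimpleGraph V} {m : ℕ} (hG : G ∈ graphsWith V m) (φ : ℕ → ℝ)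
    {T : Finset V} (hT : arcs G T = ∅) :
    ∑ e ∈ arcs Gᶜ Finset.univ, afterPair φ e T =
      2 * (((Fintype.card V).choose 2 : ℝ) - m) * φ T.card -
        (T.card : ℝ) * (T.card - 1) * (φ T.card - φ (T.card - 1)) := by
  have hsplit : ∀ e : V × V, afterPair φ e T =
      φ T.card - (if e.1 ∈ T ∧ e.2 ∈ T then φ T.card - φ (T.card - 1) else 0) := by
    intro e
    unfold afterPair
    split_ifs <;> ring
  have hfilter : (arcs Gᶜ Finset.univ).filter (fun e => e.1 ∈ T ∧ e.2 ∈ T) = T.offDiag := by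
    ext e
    have hadj : e.1 ∈ T → e.2 ∈ T → ¬G.Adj e.1 e.2 := fun h1 h2 h => by
      have : e ∈ arcs G T := mem_arcs.mpr ⟨h, h1, h2⟩
      simp [hT] at this
    simp only [Finset.mem_filter, mem_arcs, SimpleGraph.compl_adj, Finset.mem_univ, and_true,
      Finset.mem_offDiag]
    tauto
  have hcast : ∀ a : ℕ, ((a * a - a : ℕ) : ℝ) = a * (a - 1) := by
    intro a
    rw [Nat.cast_sub (Nat.le_mul_self a)]
    push_cast
    ring
  have hcard := card_arcs_compl G
  rw [mem_graphsWith.mp hG] at hcard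
  have hcard' := congrArg (Nat.cast : ℕ → ℝ) hcard
  rw [hcast] at hcard'
  push_cast at hcard'
  simp only [hsplit]
  rw [Finset.sum_sub_distrib, ← Finset.sum_filter, hfilter, Finset.sum_const, Finset.sum_const,
    Finset.offDiag_card, nsmul_eq_mul, nsmul_eq_mul, hcast, Nat.cast_choose_two]
  rw [eq_sub_of_add_eq hcard']
  ring

/-- The sum over all graphs with `m` edges of the expectation of `φ` at the final number of active
vertices. -/
noncomputable def totalValue (V : Type*) [Fintype V] (m : ℕ) (φ : ℕ → ℝ) : ℝ :=
  ∑ G ∈ graphsWith V m, endValue G (fun T => φ T.card) (Fintype.card V) Finset.univ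

theorem totalValue_succ (m : ℕ) (φ : ℕ → ℝ) :
    2 * ((m : ℝ) + 1) * totalValue V (m + 1) φ =
      totalValue V m (fun a => 2 * (((Fintype.card V).choose 2 : ℝ) - m) * φ a -
        (a : ℝ) * (a - 1) * (φ a - φ (a - 1))) := by
  have h := sum_graphsWith_succ (V := V) m
    (fun G e => endValue G (afterPair φ e) (Fintype.card V) Finset.univ)
  have hl : ∀ H ∈ graphsWith V (m + 1), ∑ e ∈ arcs H Finset.univ,
      endValue (H.deleteEdges {s(e.1, e.2)}) (afterPair φ e) (Fintype.card V) Finset.univ =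
      2 * ((m : ℝ) + 1) * endValue H (fun T => φ T.card) (Fintype.card V) Finset.univ := by
    intro H hH
    rw [sum_endValue_deleteEdges H φ _ Finset.card_univ.le subset_rfl (fun e he => (mem_arcs.mp he).1),
      mem_graphsWith.mp hH]
    push_cast
    ring
  have hr : ∀ G ∈ graphsWith V m, ∑ e ∈ arcs Gᶜ Finset.univ,
      endValue G (afterPair φ e) (Fintype.card V) Finset.univ =
      endValue G (fun T => 2 * (((Fintype.card V).choose 2 : ℝ) - m) * φ T.card -
        (T.card : ℝ) * (T.card - 1) * (φ T.card - φ (T.card - 1))) (Fintype.card V)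
          Finset.univ := by
    intro G hG
    rw [← endValue_sum]
    exact endValue_congr_of_card_le (fun T hT => sum_afterPair hG φ hT) _ le_rfl
  rw [Finset.sum_congr rfl hl, Finset.sum_congr rfl hr, ← Finset.mul_sum] at h
  exact h

theorem totalValue_const (m : ℕ) (c : ℝ) :
    totalValue V m (fun _ => c) = (graphsWith V m).card * c := by
  simp [totalValue, endValue_const]

/-- The normalising constants obey the case `φ = 1` of the same recursion. -/
theorem card_graphsWith_succ (m : ℕ) :
    ((m : ℝ) + 1) * (graphsWith V (m + 1)).card =
      (((Fintype.card V).choose 2 : ℝ) - m) * (graphsWith V m).card := by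
  have h := totalValue_succ (V := V) m (fun _ => 1)
  simp only [sub_self, mul_zero, sub_zero, mul_one, totalValue_const] at h
  linarith

theorem totalValue_zero (φ : ℕ → ℝ) :
    totalValue V 0 φ = (graphsWith V 0).card * φ (Fintype.card V) := by
  rw [totalValue, ← nsmul_eq_mul, ← Finset.sum_const]
  refine Finset.sum_congr rfl fun G hG => ?_
  rw [endValue_of_arcs_eq_empty _ _ (Finset.card_eq_zero.mp (mem_graphsWith.mp hG)),
    Finset.card_univ]

end DoubleCounting

/-! ### From the `PMF` process to the recursive expectation. -/

section Expectation

open scoped Classical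

/-- The expectation of `f` under a probability mass function on a finite type. -/
noncomputable def expect {α : Type*} [Fintype α] (p : PMF α) (f : α → ℝ) : ℝ :=
  ∑ a, (p a).toReal * f a

theorem expect_pure {α : Type*} [Fintype α] (a : α) (f : α → ℝ) :
    expect (PMF.pure a) f = f a := by
  simp [expect, PMF.pure_apply, apply_ite ENNReal.toReal]

theorem expect_bind {α β : Type*} [Fintype α] [Fintype β] (p : PMF α) (q : α → PMF β)
    (f : β → ℝ) : expect (p.bind q) f = expect p fun a => expect (q a) f := by
  have h : ∀ b, ((p.bind q) b).toReal = ∑ a, (p a).toReal * (q a b).toReal := by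
    intro b
    rw [PMF.bind_apply, tsum_fintype, ENNReal.toReal_sum]
    · simp only [ENNReal.toReal_mul]
    · exact fun a _ => ENNReal.mul_ne_top (PMF.apply_ne_top _ _) (PMF.apply_ne_top _ _)
  simp only [expect, h, Finset.sum_mul, Finset.mul_sum]
  rw [Finset.sum_comm]
  simp only [mul_assoc]

theorem expect_map {α β : Type*} [Fintype α] [Fintype β] (p : PMF α) (g : α → β) (f : β → ℝ) :
    expect (p.map g) f = expect p fun a => f (g a) := by
  rw [PMF.map, expect_bind]
  simp [expect_pure]

theorem expect_uniformOfFinset {α : Type*} [Fintype α] (s : Finset α) (hs : s.Nonempty)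
    (f : α → ℝ) : expect (PMF.uniformOfFinset s hs) f = (∑ a ∈ s, f a) / s.card := by
  simp [expect, PMF.uniformOfFinset_apply, apply_ite ENNReal.toReal, div_eq_inv_mul,
    Finset.mul_sum]

variable {V : Type*} [Fintype V]

theorem active_update (σ : State V) (v u : V) :
    active (Function.update σ v (some u)) = (active σ).erase v := by
  ext w
  by_cases hw : w = v
  · subst hw; simp [active]
  · simp [active, hw]

theorem expect_step (G : SimpleGraph V) (ψ : Finset V → ℝ) (k : ℕ) (σ : State V) :
    expect (step G σ) (fun τ => endValue G ψ k (active τ)) = endValue G ψ (k + 1) (active σ) := by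
  have harcs : activeEdges G σ = arcs G (active σ) := rfl
  unfold step
  split_ifs with h
  · rw [expect_map, expect_uniformOfFinset]
    simp only [active_update]
    rw [endValue, if_pos (by rwa [← harcs]), harcs]
  · rw [harcs, Finset.not_nonempty_iff_eq_empty] at h
    rw [expect_pure, endValue_of_arcs_eq_empty _ _ h, endValue_of_arcs_eq_empty _ _ h]

theorem expect_run (G : SimpleGraph V) (ψ : Finset V → ℝ) (j k : ℕ) :
    expect (run G k) (fun σ => endValue G ψ j (active σ)) =
      endValue G ψ (j + k) Finset.univ := by
  induction k generalizing j with
  | zero =>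
    rw [run, expect_pure]
    congr 1
    simp [active, initial]
  | succ k ih =>
    rw [run, expect_bind]
    simp only [expect_step]
    rw [ih, show j + 1 + k = j + (k + 1) by omega]

theorem expect_final (G : SimpleGraph V) (ψ : Finset V → ℝ) :
    expect (final G) (fun σ => ψ (active σ)) =
      endValue G ψ (Fintype.card V) Finset.univ := by
  have h := expect_run G ψ 0 (Fintype.card V)
  rw [zero_add] at h
  exact h

end Expectation

/-! ### The recursion for the law of the number of active vertices. -/

section ActiveLaw

open MeasureTheory
open scoped Classical

/-- The law of `a(m)` as the image of a law on a finite type. -/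
theorem activeLaw_eq_map (n m : ℕ) (hm : m ≤ n.choose 2) :
    activeLaw n m hm = ((gnm n m hm).bind final).map fun σ => (active σ).card := by
  rw [activeLaw, PMF.map_bind]

theorem integral_pmf_map {α : Type*} [Fintype α] (p : PMF α) (g : α → ℕ) (φ : ℕ → ℝ) :
    Integrable φ (p.map g).toMeasure ∧
      ∫ k, φ k ∂(p.map g).toMeasure = expect p fun a => φ (g a) := by
  let _ : MeasurableSpace α := ⊤
  have : MeasurableSingletonClass α := ⟨fun _ => trivial⟩
  have hg : Measurable g := fun _ _ => trivial
  have hφ : AEStronglyMeasurable φ (Measure.map g p.toMeasure) :=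
    Measurable.aestronglyMeasurable (measurable_of_countable φ)
  rw [← PMF.toMeasure_map g p hg]
  refine ⟨?_, ?_⟩
  · rw [integrable_map_measure hφ hg.aemeasurable]
    exact Integrable.of_finite
  · rw [integral_map hg.aemeasurable hφ, PMF.integral_eq_sum]
    rfl

theorem integrable_activeLaw (n m : ℕ) (hm : m ≤ n.choose 2) (φ : ℕ → ℝ) :
    Integrable φ (activeLaw n m hm).toMeasure := by
  rw [activeLaw_eq_map]
  exact (integral_pmf_map _ _ φ).1

theorem integral_activeLaw (n m : ℕ) (hm : m ≤ n.choose 2) (φ : ℕ → ℝ) :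
    ∫ k, φ k ∂(activeLaw n m hm).toMeasure =
      totalValue (Fin n) m φ / (graphsWith (Fin n) m).card := by
  rw [activeLaw_eq_map, (integral_pmf_map _ _ φ).2, expect_bind, gnm, expect_uniformOfFinset]
  congr 1
  refine Finset.sum_congr rfl fun G _ => ?_
  convert expect_final G (fun T => φ T.card)

theorem integral_activeLaw_zero (n : ℕ) (φ : ℕ → ℝ) :
    ∫ k, φ k ∂(activeLaw n 0 (Nat.zero_le _)).toMeasure = φ n := by
  have h : ((graphsWith (Fin n) 0).card : ℝ) ≠ 0 := by
    exact_mod_cast (graphsWith_nonempty (Nat.zero_le _)).card_ne_zero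
  rw [integral_activeLaw, totalValue_zero, Fintype.card_fin]
  field_simp

/-- Adding one edge to the random graph lowers the final number `a` of active vertices by one with
conditional probability `a (a - 1) / (2 (N - m))`. -/
theorem integral_activeLaw_succ (n m : ℕ) (hm : m + 1 ≤ n.choose 2) (φ : ℕ → ℝ) :
    ((n.choose 2 : ℝ) - m) * ∫ k, φ k ∂(activeLaw n (m + 1) hm).toMeasure =
      ((n.choose 2 : ℝ) - m) * ∫ k, φ k ∂(activeLaw n m (Nat.le_of_succ_le hm)).toMeasure -
        ∫ k, (k : ℝ) * (k - 1) / 2 * (φ k - φ (k - 1))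
          ∂(activeLaw n m (Nat.le_of_succ_le hm)).toMeasure := by
  have hm' := Nat.le_of_succ_le hm
  have h0 : ((graphsWith (Fin n) m).card : ℝ) ≠ 0 := by
    exact_mod_cast (graphsWith_nonempty hm').card_ne_zero
  have h1 : ((graphsWith (Fin n) (m + 1)).card : ℝ) ≠ 0 := by
    exact_mod_cast (graphsWith_nonempty hm).card_ne_zero
  have hs := totalValue_succ (V := Fin n) m φ
  have hc := card_graphsWith_succ (V := Fin n) m
  rw [Fintype.card_fin] at hs hc
  have key : ((n.choose 2 : ℝ) - m) * ∫ k, φ k ∂(activeLaw n (m + 1) hm).toMeasure =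
      ∫ k, (2 * ((n.choose 2 : ℝ) - m) * φ k - (k : ℝ) * (k - 1) * (φ k - φ (k - 1))) / 2
        ∂(activeLaw n m hm').toMeasure := by
    rw [integral_div, integral_activeLaw, integral_activeLaw, ← hs]
    field_simp
    linear_combination (-totalValue (Fin n) (m + 1) φ) * hc
  rw [key, ← integral_const_mul, ← integral_sub (integrable_activeLaw _ _ _ _)
    (integrable_activeLaw _ _ _ _)]
  congr 1
  ext k
  ring

end ActiveLaw

open MeasureTheory

/-! ### First moment and the exactly solvable inverse moment. -/

section Moments

theorem expectedActive_zero (n : ℕ) : expectedActive n 0 (Nat.zero_le _) = n :=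
  integral_activeLaw_zero n fun k => (k : ℝ)

theorem expectedActive_succ (n m : ℕ) (hm : m + 1 ≤ n.choose 2) :
    ((n.choose 2 : ℝ) - m) * expectedActive n (m + 1) hm =
      ((n.choose 2 : ℝ) - m) * expectedActive n m (Nat.le_of_succ_le hm) -
        ∫ k : ℕ, (k : ℝ) * (k - 1) / 2 ∂(activeLaw n m (Nat.le_of_succ_le hm)).toMeasure := by
  have h := integral_activeLaw_succ n m hm fun k => (k : ℝ)
  unfold expectedActive
  rw [h]
  congr 2
  ext k
  rcases k with _ | k
  · simp
  · simp

/-- The death rate `k(k-1)/2` vanishes at `k = 1`, so the chain never reaches `0`. -/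
theorem integral_activeLaw_eq_zero (n m : ℕ) (hm : m ≤ n.choose 2) (hn : 1 ≤ n) :
    ∫ k : ℕ, (if k = 0 then 1 else 0 : ℝ) ∂(activeLaw n m hm).toMeasure = 0 := by
  induction m with
  | zero =>
    rw [integral_activeLaw_zero, if_neg (by omega)]
  | succ m ih =>
    have hL : (0 : ℝ) < (n.choose 2 : ℝ) - m := by
      have : ((m + 1 : ℕ) : ℝ) ≤ n.choose 2 := by exact_mod_cast hm
      push_cast at this
      linarith
    have h := integral_activeLaw_succ n m hm fun k => if k = 0 then 1 else 0
    have h0 : ∀ k : ℕ, (k : ℝ) * (k - 1) / 2 *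
        ((if k = 0 then 1 else 0) - (if k - 1 = 0 then 1 else 0)) = 0 := by
      intro k
      rcases k with _ | _ | k <;> simp
    rw [ih] at h
    simp only [h0, integral_zero, mul_zero, sub_zero] at h
    exact (mul_eq_zero.mp h).resolve_left hL.ne'

theorem integral_inv_activeLaw (n m : ℕ) (hm : m ≤ n.choose 2) (hn : 1 ≤ n) :
    ∫ k : ℕ, 1 / ((k : ℝ) + 1) ∂(activeLaw n m hm).toMeasure =
      ((n : ℝ) + m) / (n * (n + 1)) := by
  have hn0 : (0 : ℝ) < n := by exact_mod_cast hn
  induction m with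
  | zero =>
    rw [integral_activeLaw_zero n fun k => 1 / ((k : ℝ) + 1)]
    push_cast
    field_simp
    ring
  | succ m ih =>
    have hm' := Nat.le_of_succ_le hm
    have hL : (0 : ℝ) < (n.choose 2 : ℝ) - m := by
      have : ((m + 1 : ℕ) : ℝ) ≤ n.choose 2 := by exact_mod_cast hm
      push_cast at this
      linarith
    have h := integral_activeLaw_succ n m hm fun k => 1 / ((k : ℝ) + 1)
    -- The generator maps `1/(k+1)` to itself up to a constant, which closes the recursion. The
    -- indicator corrects `k = 0`, where `k - 1` truncates.
    have h1 : ∀ k : ℕ, (k : ℝ) * (k - 1) / 2 *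
        (1 / ((k : ℝ) + 1) - 1 / (((k - 1 : ℕ) : ℝ) + 1)) =
        1 / ((k : ℝ) + 1) - 1 / 2 - 1 / 2 * (if k = 0 then 1 else 0) := by
      intro k
      rcases k with _ | k
      · norm_num
      · push_cast
        simp
        field_simp
        ring
    simp only [h1] at h
    rw [integral_sub (integrable_activeLaw _ _ _ _) (integrable_activeLaw _ _ _ _),
      integral_sub (integrable_activeLaw _ _ _ _) (integrable_activeLaw _ _ _ _),
      integral_const_mul, integral_activeLaw_eq_zero n m hm' hn, ih hm'] at h
    simp only [integral_const, probReal_univ, smul_eq_mul, one_mul, mul_zero, sub_zero] at h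
    apply mul_left_cancel₀ hL.ne'
    rw [h, Nat.cast_choose_two]
    push_cast
    field_simp
    ring

end Moments

/-! ### Comparison with the mean field. -/

section UpperBound

/-- One step of the comparison with the mean field, in the range where the mean field is at most
two. -/
theorem meanField_step_of_le_half {L r s : ℝ} (hL : 0 < L) (hr : 0 ≤ r) (hr2 : r ≤ 1 / 2)
    (hs : 0 ≤ s) (hLs : L * (1 - s ^ 2) = 1) :
    L * (1 / (1 - r)) - (1 / (1 - r) - 1) ≤ L * (1 / (1 - r * s)) := by
  have hs1 : s ≤ 1 := by
    by_contra! h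
    have : 1 - s ^ 2 < 0 := by nlinarith
    linarith [mul_neg_of_pos_of_neg hL this]
  have hrs : 0 < 1 - r * s := by nlinarith
  have hr1 : 0 < 1 - r := by linarith
  have h1 : L * (1 / (1 - r)) - (1 / (1 - r) - 1) = (L - r) / (1 - r) := by
    field_simp
    ring
  rw [h1, mul_one_div, div_le_div_iff₀ hr1 hrs]
  have h2 : L * (1 - r) - (L - r) * (1 - r * s) =
      L * (r * s * (1 - s) * (1 - r * (1 + s))) := by
    linear_combination (- r * (1 - r * s)) * hLs
  have h3 : 0 ≤ L * (r * s * (1 - s) * (1 - r * (1 + s))) := by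
    have : 0 ≤ 1 - s := by linarith
    have : 0 ≤ 1 - r * (1 + s) := by nlinarith
    positivity
  linarith

/-- One step of the comparison with the mean field, in the range where the mean field is at least
two. -/
theorem meanField_step_of_half_le {L r s : ℝ} (hL : 0 < L) (hr2 : 1 / 2 ≤ r) (hr1 : r < 1)
    (hs : 0 ≤ s) (hLs : L * (1 - s ^ 2) = 1) :
    L * (1 / (1 - r)) - 1 / (1 - r) * (1 / (1 - r) - 1) / 2 ≤ L * (1 / (1 - r * s)) := by
  have hs1 : s ≤ 1 := by
    by_contra! h
    have : 1 - s ^ 2 < 0 := by nlinarith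
    linarith [mul_neg_of_pos_of_neg hL this]
  have hr : 0 ≤ r := by linarith
  have hrs : 0 < 1 - r * s := by nlinarith
  have hr1' : 0 < 1 - r := by linarith
  have h1 : L * (1 / (1 - r)) - 1 / (1 - r) * (1 / (1 - r) - 1) / 2 =
      (L * (1 - r) - r / 2) / (1 - r) ^ 2 := by
    field_simp
    ring
  rw [h1, mul_one_div, div_le_div_iff₀ (by positivity) hrs]
  have h2 : L * (1 - r) ^ 2 - (L * (1 - r) - r / 2) * (1 - r * s) =
      L * (r * (1 - s) ^ 2 * (r * (2 + s) - 1)) / 2 := by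
    linear_combination (- r / 2 * (1 - r * s)) * hLs
  have h3 : 0 ≤ L * (r * (1 - s) ^ 2 * (r * (2 + s) - 1)) / 2 := by
    have : 0 ≤ r * (2 + s) - 1 := by nlinarith
    positivity
  linarith

/-- In the range where the mean field is at least two, its discrete evolution is monotone. -/
theorem meanField_slope_le {n : ℕ} {L r : ℝ} (hr2 : 1 / 2 < r) (hn : 2 ≤ n)
    (hrn : r ≤ 1 - 1 / n) (hLr : r ^ 2 * n ^ 3 = 2 * L * (n - 1)) :
    2 * (1 / (1 - r)) - 1 ≤ 2 * L := by
  have hn0 : (0 : ℝ) < n := by positivity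
  have hr1 : 0 < 1 - r := by
    have : (0 : ℝ) < 1 / n := by positivity
    linarith
  have hrn' : 1 ≤ (1 - r) * n := by
    have : (1 : ℝ) / n ≤ 1 - r := by linarith
    rwa [div_le_iff₀ hn0] at this
  have h1 : 2 * (1 / (1 - r)) - 1 = (1 + r) / (1 - r) := by
    field_simp
    ring
  rw [h1, div_le_iff₀ hr1]
  have hn1 : (0 : ℝ) < n - 1 := by
    have : (2 : ℝ) ≤ n := by exact_mod_cast hn
    linarith
  refine le_of_mul_le_mul_right ?_ hn1
  have h2 : 2 * L * (1 - r) * (n - 1) = r ^ 2 * n ^ 3 * (1 - r) := by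
    rw [hLr]
    ring
  rw [h2]
  -- The general argument needs `3(n-1) ≤ n²/2`, which fails for `n = 2, 3, 4`.
  rcases Nat.lt_or_ge n 5 with h5 | h5
  · interval_cases n
    · norm_num at hrn
      linarith
    · norm_num at hrn ⊢
      have : 0 ≤ (r - 1 / 2) * (2 / 3 - r) := mul_nonneg (by linarith) (by linarith)
      nlinarith
    · norm_num at hrn ⊢
      have : 0 ≤ (r - 1 / 2) * (3 / 4 - r) := mul_nonneg (by linarith) (by linarith)
      nlinarith
  · have h5' : (5 : ℝ) ≤ n := by exact_mod_cast h5
    have h3 : r ^ 2 * n ^ 2 ≤ r ^ 2 * n ^ 3 * (1 - r) := by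
      have : 0 ≤ r ^ 2 * n ^ 2 * ((1 - r) * n - 1) := by
        have : 0 ≤ (1 - r) * n - 1 := by linarith
        positivity
      nlinarith
    have h4 : (1 + r) * (n - 1) ≤ 3 * r * (n - 1) := by nlinarith
    have h6 : 3 * r * (n - 1) ≤ r * (r * (n : ℝ) ^ 2) := by
      have : 3 * ((n : ℝ) - 1) ≤ r * (n : ℝ) ^ 2 := by nlinarith
      nlinarith
    nlinarith

/-- Bounding `k(k-1)/2` below by an affine function turns the recursion into an affine map of `E a`.
As long as that map is increasing, `E a` may be replaced by the mean field `1/(1-r)`; one step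
multiplies `r` by `s = √(1-1/L)`. -/
theorem expectedActive_le_meanField (n m : ℕ) (hm : m ≤ n.choose 2) (hn : 2 ≤ n) :
    expectedActive n m hm ≤ meanField n m := by
  have hn2 : (2 : ℝ) ≤ n := by exact_mod_cast hn
  have hn0 : (0 : ℝ) < n := by linarith
  induction m with
  | zero =>
    rw [expectedActive_zero]
    simp [meanField]
  | succ m ih =>
    have hm' := Nat.le_of_succ_le hm
    have ih := ih hm'
    set N : ℝ := (n.choose 2 : ℝ) with hN
    have hNn : N = n * (n - 1) / 2 := Nat.cast_choose_two ℝ n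
    have hN0 : 0 < N := by
      rw [hNn]
      have : 0 < (n : ℝ) - 1 := by linarith
      positivity
    have hL1 : 1 ≤ N - m := by
      have : ((m + 1 : ℕ) : ℝ) ≤ n.choose 2 := by exact_mod_cast hm
      push_cast at this
      rw [hN]
      linarith
    set L : ℝ := N - m with hL
    have hL0 : 0 < L := by linarith
    set c : ℝ := 1 - 1 / (n : ℝ) with hc
    have hc0 : 0 ≤ c := by
      have : 1 / (n : ℝ) ≤ 1 := by rw [div_le_one hn0]; linarith
      linarith
    have hc1 : c < 1 := by
      have : 0 < 1 / (n : ℝ) := by positivity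
      linarith
    set r : ℝ := c * Real.sqrt (1 - m / N) with hr
    set s : ℝ := Real.sqrt (1 - 1 / L) with hs
    have hx : 1 - (m : ℝ) / N = L / N := by
      rw [hL]
      field_simp
    have hs2 : s ^ 2 = 1 - 1 / L := Real.sq_sqrt (by
      have : 1 / L ≤ 1 := by rw [div_le_one hL0]; exact hL1
      linarith)
    have hLs : L * (1 - s ^ 2) = 1 := by
      rw [hs2]
      field_simp
      ring
    have hs0 : 0 ≤ s := Real.sqrt_nonneg _
    have hr0 : 0 ≤ r := mul_nonneg hc0 (Real.sqrt_nonneg _)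
    have hrc : r ≤ c := by
      have : Real.sqrt (1 - m / N) ≤ 1 := by
        rw [Real.sqrt_le_one]
        have : 0 ≤ (m : ℝ) / N := by positivity
        linarith
      nlinarith
    have hr2 : r ^ 2 * n ^ 3 = 2 * L * (n - 1) := by
      rw [hr, mul_pow, Real.sq_sqrt (by rw [hx]; positivity), hx, hNn, hc]
      have : (n : ℝ) - 1 ≠ 0 := by linarith
      field_simp
    have hrs : meanField n (m + 1) = 1 / (1 - r * s) := by
      rw [meanField, hr, hs, mul_assoc, ← Real.sqrt_mul (by rw [hx]; positivity), hx]
      congr 4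
      rw [← hN, hL]
      push_cast
      have : N - m ≠ 0 := by rw [← hL]; exact hL0.ne'
      field_simp
      ring
    have hf : meanField n m = 1 / (1 - r) := rfl
    rw [hrs]
    rw [hf] at ih
    refine le_of_mul_le_mul_left ?_ hL0
    rw [expectedActive_succ n m hm]
    have hint := integrable_activeLaw n m hm'
    set α : ℝ := expectedActive n m hm' with hα
    set f : ℝ := 1 / (1 - r) with hf'
    have hlin : ∀ a b : ℝ, ∫ k : ℕ, (a * (k : ℝ) + b) ∂(activeLaw n m hm').toMeasure =
        a * α + b := by
      intro a b
      rw [integral_add (hint _) (hint _), integral_const_mul]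
      simp [hα, expectedActive]
    -- The mean field is at most `2` iff `r ≤ 1/2`. There the integrality bound `k(k-1)/2 ≥ k - 1`
    -- is used; above `2`, the tangent line at the mean field.
    rcases le_or_gt r (1 / 2) with hhalf | hhalf
    · refine le_trans ?_ (meanField_step_of_le_half hL0 hr0 hhalf hs0 hLs)
      have hge : α - 1 ≤ ∫ k : ℕ, (k : ℝ) * (k - 1) / 2 ∂(activeLaw n m hm').toMeasure := by
        have := integral_mono (hint fun k : ℕ => 1 * (k : ℝ) + (-1))
          (hint fun k : ℕ => (k : ℝ) * (k - 1) / 2) ?_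
        · rw [hlin] at this
          linarith
        · intro k
          rcases k with _ | _ | k
          · norm_num
          · norm_num
          · push_cast
            nlinarith [(Nat.cast_nonneg k : (0 : ℝ) ≤ k)]
      linarith [mul_nonneg (sub_nonneg.mpr ih) (sub_nonneg.mpr hL1)]
    · refine le_trans ?_
        (meanField_step_of_half_le hL0 hhalf.le (lt_of_le_of_lt hrc hc1) hs0 hLs)
      have hslope := meanField_slope_le hhalf hn hrc hr2
      have hge : (2 * f - 1) / 2 * α + (f * (f - 1) - (2 * f - 1) * f) / 2 ≤
          ∫ k : ℕ, (k : ℝ) * (k - 1) / 2 ∂(activeLaw n m hm').toMeasure := by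
        rw [← hlin]
        refine integral_mono (hint _) (hint _) fun k => ?_
        simp only
        nlinarith [sq_nonneg ((k : ℝ) - f)]
      rw [← hf'] at hslope ⊢
      linarith [mul_nonneg (sub_nonneg.mpr ih) (sub_nonneg.mpr hslope)]

theorem meanField_le (n m : ℕ) (hm : m ≤ n.choose 2) (hn : 2 ≤ n) :
    meanField n m ≤ (n : ℝ) ^ 2 / (n + m) := by
  have hn2 : (2 : ℝ) ≤ n := by exact_mod_cast hn
  have hn1 : (0 : ℝ) < n - 1 := by linarith
  have hmN : (m : ℝ) ≤ n.choose 2 := by exact_mod_cast hm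
  rw [meanField]
  rw [Nat.cast_choose_two] at hmN ⊢
  set x : ℝ := (m : ℝ) / (n * (n - 1) / 2) with hx
  have hx1 : x ≤ 1 := by
    rw [hx, div_le_one (by positivity)]
    exact hmN
  have hsq : Real.sqrt (1 - x) ≤ 1 - x / 2 := by
    rw [Real.sqrt_le_iff]
    constructor <;> nlinarith [sq_nonneg x]
  have hkey : ((n : ℝ) + m) / n ^ 2 ≤ 1 - (1 - 1 / (n : ℝ)) * Real.sqrt (1 - x) := by
    have hc : 0 ≤ 1 - 1 / (n : ℝ) := by
      have : 1 / (n : ℝ) ≤ 1 := by rw [div_le_one (by positivity)]; linarith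
      linarith
    have h1 := mul_le_mul_of_nonneg_left hsq hc
    have h2 : 1 - (1 - 1 / (n : ℝ)) * (1 - x / 2) = ((n : ℝ) + m) / n ^ 2 := by
      rw [hx]
      field_simp
      ring
    linarith
  have hpos : 0 < ((n : ℝ) + m) / n ^ 2 := by positivity
  rw [← one_div_div ((n : ℝ) + m)]
  exact one_div_le_one_div_of_le hpos hkey

end UpperBound

/-! ### Lower bound and concentration from the inverse moment. -/

section Concentration

/-- The expected relative deviation of `a(m) + 1` from `B = n (n + 1) / (n + m)`. -/
theorem integral_deviation (n m : ℕ) (hm : m ≤ n.choose 2) (hn : 1 ≤ n) {B : ℝ}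
    (hB : B = (n : ℝ) * (n + 1) / (n + m)) :
    ∫ k : ℕ, ((k : ℝ) + 1 - B) ^ 2 / (B * (k + 1)) ∂(activeLaw n m hm).toMeasure =
      (expectedActive n m hm + 1) / B - 1 := by
  have hn0 : (0 : ℝ) < n := by exact_mod_cast hn
  have hB0 : 0 < B := by
    rw [hB]
    positivity
  -- With `y = k + 1` this is `y/B + B/y - 2`, and `E (B/y) = 1`.
  have h : ∀ k : ℕ, ((k : ℝ) + 1 - B) ^ 2 / (B * (k + 1)) =
      1 / B * (k : ℝ) + B * (1 / ((k : ℝ) + 1)) + (1 / B - 2) := by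
    intro k
    field_simp
    ring
  simp only [h]
  rw [integral_add (integrable_activeLaw _ _ _ _) (integrable_activeLaw _ _ _ _),
    integral_add (integrable_activeLaw _ _ _ _) (integrable_activeLaw _ _ _ _),
    integral_const_mul, integral_const_mul, integral_inv_activeLaw n m hm hn]
  have h1 : B * (((n : ℝ) + m) / (n * (n + 1))) = 1 := by
    rw [hB]
    field_simp
  rw [h1, ← expectedActive]
  simp only [integral_const, probReal_univ, smul_eq_mul, one_mul]
  ring

theorem le_expectedActive (n m : ℕ) (hm : m ≤ n.choose 2) (hn : 1 ≤ n) :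
    (n : ℝ) * (n + 1) / (n + m) - 1 ≤ expectedActive n m hm := by
  have hn0 : (0 : ℝ) < n := by exact_mod_cast hn
  have hB0 : 0 < (n : ℝ) * (n + 1) / (n + m) := by positivity
  have h := integral_deviation n m hm hn rfl
  have h0 : 0 ≤ (expectedActive n m hm + 1) / ((n : ℝ) * (n + 1) / (n + m)) - 1 := by
    rw [← h]
    exact integral_nonneg fun k => by positivity
  have h1 := (one_le_div hB0).mp (sub_nonneg.mp h0)
  linarith

theorem expectedActive_le (n m : ℕ) (hm : m ≤ n.choose 2) (hn : 2 ≤ n) :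
    expectedActive n m hm ≤ (n : ℝ) ^ 2 / (n + m) :=
  (expectedActive_le_meanField n m hm hn).trans (meanField_le n m hm hn)

/-- Since `y ≤ B + t` for `t = |y - B|`, the quotient is at least `t²/(B(B+t))`, which increases in
`t`; the constant is its value at `t = δB`. -/
theorem le_sq_div_of_le_abs_sub {δ B y : ℝ} (hδ : 0 < δ) (hB : 0 < B) (hy : 0 < y)
    (h : δ * B ≤ |y - B|) : δ ^ 2 / (1 + δ) ≤ (y - B) ^ 2 / (B * y) := by
  have hyB : y ≤ B + |y - B| := by linarith [le_abs_self (y - B)]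
  rw [← sq_abs (y - B)]
  set t := |y - B|
  have ht : 0 < t := lt_of_lt_of_le (by positivity) h
  calc δ ^ 2 / (1 + δ) ≤ t ^ 2 / (B * (B + t)) := by
        rw [div_le_div_iff₀ (by positivity) (by positivity)]
        have h1 : 0 ≤ (t - δ * B) * (t + δ * B + δ * t) :=
          mul_nonneg (by linarith) (by positivity)
        nlinarith
    _ ≤ t ^ 2 / (B * y) := by gcongr

/-- The probability of a deviation of `a(m)` from its mean by a factor is `O(1 / B)`. -/
theorem measure_deviation_le (n m : ℕ) (hm : m ≤ n.choose 2) (hn : 2 ≤ n) {ε B : ℝ} (hε : 0 < ε)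
    (hB : B = (n : ℝ) * (n + 1) / (n + m)) (hBε : 2 * (1 + ε) / ε ≤ B) :
    (activeLaw n m hm).toMeasure
      {k : ℕ | ε * expectedActive n m hm ≤ |(k : ℝ) - expectedActive n m hm|} ≤
      ENNReal.ofReal ((1 + ε / 2) / (ε / 2) ^ 2 * (1 / B)) := by
  have hn0 : (0 : ℝ) < n := by positivity
  have hB0 : 0 < B := by
    rw [hB]
    positivity
  have hlow : B - 1 ≤ expectedActive n m hm := by
    rw [hB]
    exact le_expectedActive n m hm (by omega)
  have hup : expectedActive n m hm ≤ B := by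
    refine (expectedActive_le n m hm hn).trans ?_
    rw [hB]
    gcongr
    nlinarith
  set μ := expectedActive n m hm with hμ
  set c : ℝ := (ε / 2) ^ 2 / (1 + ε / 2) with hc
  have hc0 : 0 < c := by positivity
  have hsub : {k : ℕ | ε * μ ≤ |(k : ℝ) - μ|} ⊆
      {k : ℕ | c ≤ ((k : ℝ) + 1 - B) ^ 2 / (B * (k + 1))} := by
    intro k hk
    rw [Set.mem_ofPred_eq] at hk ⊢
    refine le_sq_div_of_le_abs_sub (by positivity) hB0 (by positivity) ?_
    -- The mean lies in `[B - 1, B]`, so recentring costs at most `1`; `hBε` lets half of `ε` absorb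
    -- this.
    have h1 : |(k : ℝ) - μ| ≤ |(k : ℝ) + 1 - B| + 1 := by
      have h2 : (k : ℝ) - μ = ((k : ℝ) + 1 - B) + (B - 1 - μ) := by ring
      have h3 : |B - 1 - μ| ≤ 1 := abs_le.mpr ⟨by linarith, by linarith⟩
      rw [h2]
      exact (abs_add_le _ _).trans (by linarith)
    rw [div_le_iff₀ hε] at hBε
    nlinarith
  refine (measure_mono hsub).trans ?_
  rw [ENNReal.le_ofReal_iff_toReal_le (measure_ne_top _ _) (by positivity)]
  have hmarkov := mul_meas_ge_le_integral_of_nonneg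
    (μ := (activeLaw n m hm).toMeasure)
    (f := fun k : ℕ => ((k : ℝ) + 1 - B) ^ 2 / (B * (k + 1)))
    (Eventually.of_forall fun k => by simp only [Pi.zero_apply]; positivity)
    (integrable_activeLaw _ _ _ _) c
  rw [integral_deviation n m hm (by omega) hB, ← hμ] at hmarkov
  have h1 : (μ + 1) / B - 1 ≤ 1 / B := by
    rw [add_div]
    have := (div_le_one hB0).mpr hup
    linarith
  have h2 : (1 + ε / 2) / (ε / 2) ^ 2 * (1 / B) = 1 / B / c := by
    rw [hc]
    field_simp
  rw [h2, le_div_iff₀ hc0, mul_comm]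
  exact hmarkov.trans h1

end Concentration

/-! ### Limits when `m = o(n²)`. -/

section Asymptotics

theorem tendsto_div_sq_zero {ω : ℕ → ℝ} {m : ℕ → ℕ} (hω : Tendsto ω atTop atTop)
    (hmω : ∀ᶠ n in atTop, (m n : ℝ) ≤ (n.choose 2 : ℝ) / ω n) :
    Tendsto (fun n => (m n : ℝ) / (n : ℝ) ^ 2) atTop (𝓝 0) := by
  refine squeeze_zero' (Eventually.of_forall fun n => by positivity) ?_
    (tendsto_inv_atTop_zero.comp hω)
  filter_upwards [hmω, hω.eventually_gt_atTop 0, eventually_ge_atTop 1] with n h1 h2 h3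
  have hn : (1 : ℝ) ≤ n := by exact_mod_cast h3
  simp only [Function.comp]
  rw [div_le_iff₀ (by positivity)]
  refine h1.trans ?_
  rw [div_eq_inv_mul, Nat.cast_choose_two]
  gcongr
  nlinarith

theorem tendsto_inv_scale {m : ℕ → ℕ}
    (hm : Tendsto (fun n => (m n : ℝ) / (n : ℝ) ^ 2) atTop (𝓝 0)) :
    Tendsto (fun n : ℕ => 1 / ((n : ℝ) * (n + 1) / (n + m n))) atTop (𝓝 0) := by
  have h : Tendsto (fun n : ℕ => 1 / (n : ℝ) + (m n : ℝ) / (n : ℝ) ^ 2) atTop (𝓝 0) := by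
    simpa using tendsto_one_div_atTop_nhds_zero_nat.add hm
  refine squeeze_zero' (Eventually.of_forall fun n => by positivity) ?_ h
  filter_upwards [eventually_ge_atTop 1] with n hn
  have hn : (1 : ℝ) ≤ n := by exact_mod_cast hn
  have h1 : 1 / (n : ℝ) + (m n : ℝ) / (n : ℝ) ^ 2 = (n + m n) / (n : ℝ) ^ 2 := by
    field_simp
  rw [h1, one_div_div]
  gcongr
  nlinarith

/-- A quantity between `n (n + 1) / (n + m) - 1` and `n ^ 2 / (n + m)` is asymptotic to the
latter. -/
theorem isEquivalent_of_bounds {m : ℕ → ℕ} {u : ℕ → ℝ}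
    (hm : Tendsto (fun n => (m n : ℝ) / (n : ℝ) ^ 2) atTop (𝓝 0))
    (hlow : ∀ᶠ n : ℕ in atTop, (n : ℝ) * (n + 1) / (n + m n) - 1 ≤ u n)
    (hup : ∀ᶠ n : ℕ in atTop, u n ≤ (n : ℝ) ^ 2 / (n + m n)) :
    u ~[atTop] fun n => (n : ℝ) ^ 2 / ((n : ℝ) + (m n : ℝ)) := by
  refine isEquivalent_of_tendsto_one ?_
  have h1 : Tendsto (fun n => 1 - (m n : ℝ) / (n : ℝ) ^ 2) atTop (𝓝 1) := by
    simpa using tendsto_const_nhds.sub hm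
  refine tendsto_of_tendsto_of_tendsto_of_le_of_le' h1 tendsto_const_nhds ?_ ?_
  · filter_upwards [hlow, eventually_ge_atTop 1] with n h hn
    have hn : (1 : ℝ) ≤ n := by exact_mod_cast hn
    rw [Pi.div_apply, le_div_iff₀ (by positivity)]
    refine le_trans (le_of_eq ?_) h
    field_simp
    ring
  · filter_upwards [hup, eventually_ge_atTop 1] with n h hn
    have hn : (1 : ℝ) ≤ n := by exact_mod_cast hn
    rw [Pi.div_apply, div_le_one (by positivity)]
    exact h

end Asymptotics

end Joining

theorem theorem1 :
    (∀ (ω : ℕ → ℝ) (m : ℕ → ℕ) (hm : ∀ n, m n ≤ n.choose 2),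
      Tendsto ω atTop atTop →
      (∀ᶠ n in atTop, (m n : ℝ) ≤ (n.choose 2 : ℝ) / ω n) →
      (∀ ε : ℝ, 0 < ε →
        Tendsto (fun n => (Joining.activeLaw n (m n) (hm n)).toMeasure
          {k : ℕ | ε * Joining.expectedActive n (m n) (hm n) ≤
            |(k : ℝ) - Joining.expectedActive n (m n) (hm n)|}) atTop (𝓝 0)) ∧
      (fun n => Joining.expectedActive n (m n) (hm n)) ~[atTop]
        (fun n => Joining.meanField n (m n)) ∧
      (fun n => Joining.expectedActive n (m n) (hm n)) ~[atTop]
        (fun n => (n : ℝ) ^ 2 / ((n : ℝ) + (m n : ℝ)))) ∧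
    (∀ (n m : ℕ) (hm : m ≤ n.choose 2), 2 ≤ n →
      Joining.expectedActive n m hm ≤ Joining.meanField n m) := by
  refine ⟨fun ω m hm hω hmω => ?_, Joining.expectedActive_le_meanField⟩
  have hm0 := Joining.tendsto_div_sq_zero hω hmω
  have hinv := Joining.tendsto_inv_scale hm0
  have hE := Joining.isEquivalent_of_bounds
    (u := fun n => Joining.expectedActive n (m n) (hm n)) hm0
    ((eventually_ge_atTop 1).mono fun n hn => Joining.le_expectedActive n _ _ hn)
    ((eventually_ge_atTop 2).mono fun n hn => Joining.expectedActive_le n _ _ hn)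
  -- The mean field inherits its lower bound from `E a`, so the same squeeze applies to it.
  have hF := Joining.isEquivalent_of_bounds
    (u := fun n => Joining.meanField n (m n)) hm0
    ((eventually_ge_atTop 2).mono fun n hn =>
      (Joining.le_expectedActive n _ (hm n) (by omega)).trans
        (Joining.expectedActive_le_meanField n _ _ hn))
    ((eventually_ge_atTop 2).mono fun n hn => Joining.meanField_le n _ (hm n) hn)
  refine ⟨fun ε hε => ?_, hE.trans hF.symm, hE⟩
  have hlim : Tendsto (fun n : ℕ => ENNReal.ofReal
      ((1 + ε / 2) / (ε / 2) ^ 2 * (1 / ((n : ℝ) * (n + 1) / (n + m n))))) atTop (𝓝 0) := by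
    simpa using ENNReal.tendsto_ofReal (hinv.const_mul ((1 + ε / 2) / (ε / 2) ^ 2))
  refine tendsto_of_tendsto_of_tendsto_of_le_of_le' tendsto_const_nhds hlim
    (Eventually.of_forall fun n => zero_le) ?_
  have hsmall : (0 : ℝ) < 1 / (2 * (1 + ε) / ε) := by positivity
  filter_upwards [hinv.eventually_le_const hsmall, eventually_ge_atTop 2] with n h hn
  refine Joining.measure_deviation_le n (m n) (hm n) hn hε rfl ?_
  have hn0 : (0 : ℝ) < n := by positivity
  exact (one_div_le_one_div (by positivity) (by positivity)).mp h
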